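/- Let $L$ be a countable first-order language and let $M$ be a (nonempty) $L$-structure with trivial definable closure, i.e. $\mathrm{dcl}(A)=A$ for every $A\subseteq M$, where $\mathrm{dcl}(A)$ is the set of $b\in M$ that are the only solution in $M$ of some formula with parameters from $A$. Let $\{\Delta_m : m\in\omega\}$ be any countable set of partial types (sets of $L$-formulas in finitely many variables, without parameters), each omitted by $M$. Then there is an $L$-structure $N$ elementarily equivalent to $M$, of size continuum, such that: 1. The universe of $N$ is $2^\omega\times\omega$; write $a_{\eta,i}=(\eta,i)$. 2. For each $i\in\omega$ the slice $A_i=\{a_{\eta,i}:\eta\in 2^\omega\}$ is asymptotically similar; moreover, for every strictly increasing finite sequence $t=(i_1,\dots,i_m)$ from $\omega$, the family of $m$-tuples $\bar a_{\eta,t}=(a_{\eta,i_1},\dots,a_{\eta,i_m})$, $\eta\in 2^\omega$, is asymptotically similar. Here a family $(c_\eta)_{\eta\in 2^\omega}$ of elements (or of tuples of a fixed finite length) of $N$ is asymptotically similar if for every $L$-formula $\theta$ in $k$ variables (or $k$ blocks of variables) there is an integer $N_\theta$ such that for all $\ell\ge N_\theta$ $$N\models\theta(c_{\eta_0},\dots,c_{\eta_{k-1}})\leftrightarrow\theta(c_{\tau_0},\dots,c_{\tau_{k-1}})$$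 for all $k$-tuples $(\eta_j)_{j<k}$ and $(\tau_j)_{j<k}$ of distinct elements of $2^\omega$ such that the restrictions $\eta_j|\ell$ $(j<k)$ are distinct and $\eta_j|\ell=\tau_j|\ell$ for each $j<k$. 3. For every $k$, every subset of $N^k$ that is definable with parameters is a finite Boolean combination of open subsets of $(2^\omega\times\omega)^k$, with the product topology ($2^\omega$ with its standard topology, $\omega$ discrete). 4. Let $\mu$ be the measure on $2^\omega\times\omega$ with $\mu(U_a\times\{i\})=2^{-(n+i+1)}$ for every $i\in\omega$ and every $a\in 2^{<\omega}$ of length $n$, where $U_a=\{\eta\in 2^\omega : \eta \text{ extends } a\}$. For every $k$, every non-degenerate definable set $\psi(N^k,\bar b)$ is measurable and has positive measure with respect to the product measure $\mu^k$. Here $\psi(N^k,\bar b)$ is non-degenerate if it contains some $(a_1,\dots,a_k)$ with $a_1,\dots,a_k$ pairwise distinct and disjoint from $\bar b$. 5. If $M$ is atomic, then so is $N$. Here a structure is atomic if every finite tuple from it satisfies a formula $\varphi(\bar w)$ that is complete for its theory $T$, i.e. for every $\psi(\bar w)$ either $T\vdash\forall\bar w(\varphi\to\psi)$ or $T\vdash\forall\bar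 w(\varphi\to\neg\psi)$. 6. $N$ omits each $\Delta_m$. -/

import Mathlib

open FirstOrder MeasureTheory Set
open scoped FirstOrder ENNReal

universe u v w

/-! ### Model theory: definable closure, atomic structures, omitting types -/

section ModelTheory

variable (L : FirstOrder.Language.{u, v}) {M : Type w} [L.Structure M]

/-- The definable closure of `A`: all `b` such that `{b}` is the solution set of a formula
with parameters from `A`. -/
def dcl (A : Set M) : Set M := {b | A.Definable₁ L {b}}

variable (M) in
/-- Trivial definable closure: `dcl(A) = A` for every subset `A`. -/
def DclTrivial : Prop := ∀ A : Set M, dcl L A = A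

variable {L} in
/-- The formula `φ` is complete for `T`: for every formula `ψ` in the same variables,
`T ⊢ ∀w (φ → ψ)` or `T ⊢ ∀w (φ → ¬ψ)`. -/
def IsCompleteFormula (T : L.Theory) {n : ℕ} (φ : L.Formula (Fin n)) : Prop :=
  ∀ ψ : L.Formula (Fin n), T ⊨ᵇ φ.imp ψ ∨ T ⊨ᵇ φ.imp ψ.not

variable (M) in
/-- `M` is atomic: every finite tuple satisfies a complete formula for the theory of `M`. -/
def IsAtomicModel : Prop :=
  ∀ (n : ℕ) (a : Fin n → M),
    ∃ φ : L.Formula (Fin n), IsCompleteFormula (L.completeTheory M) φ ∧ φ.Realize a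

variable {L}

variable (M) in
/-- `M` omits the (partial) type `Δ`: no tuple of `M` satisfies every formula of `Δ`. -/
def OmitsType {n : ℕ} (Δ : Set (L.Formula (Fin n))) : Prop :=
  ∀ a : Fin n → M, ∃ δ ∈ Δ, ¬ δ.Realize a

/-- The subset `ψ(M^k, b)` of `M^k` defined by `ψ` with parameters `b`. -/
def solutionSet {k m : ℕ} (ψ : L.Formula (Fin k ⊕ Fin m)) (b : Fin m → M) : Set (Fin k → M) :=
  {x | ψ.Realize (Sum.elim x b)}

/-- `ψ(M^k, b)` is non-degenerate: it contains a tuple with pairwise distinct entries, none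
of which is an entry of `b`. -/
def IsNondegenerate {k m : ℕ} (ψ : L.Formula (Fin k ⊕ Fin m)) (b : Fin m → M) : Prop :=
  ∃ a ∈ solutionSet ψ b, Function.Injective a ∧ ∀ i j, a i ≠ b j

end ModelTheory

/-! ### Cantor space and asymptotic similarity -/

/-- The Cantor space `2^ω`; its topology and σ-algebra are the product ones. -/
abbrev Cantor : Type := ℕ → Bool

/-- The restriction of `η ∈ 2^ω` to its first `ℓ` entries. -/
def restr (ℓ : ℕ) (η : Cantor) : Fin ℓ → Bool := fun j => η j

/-- A tuple from `2^ω` of distinct elements splits by `ℓ` if the restrictions to `2^ℓ` are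
distinct. -/
def SplitsBy (ℓ : ℕ) {k : ℕ} (η : Fin k → Cantor) : Prop :=
  Function.Injective η ∧ Function.Injective fun i => restr ℓ (η i)

/-- Two tuples of distinct elements of `2^ω` are similar (mod `ℓ`). -/
def SimilarMod (ℓ : ℕ) {k : ℕ} (η τ : Fin k → Cantor) : Prop :=
  Function.Injective τ ∧ SplitsBy ℓ η ∧ ∀ i, restr ℓ (η i) = restr ℓ (τ i)

section Asymptotic

variable (L : FirstOrder.Language.{u, v}) {M : Type w} [L.Structure M]

/-- A family of elements indexed by `2^ω` is asymptotically similar. -/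
def AsymptoticallySimilar (a : Cantor → M) : Prop :=
  ∀ (k : ℕ) (θ : L.Formula (Fin k)), ∃ N : ℕ, ∀ ℓ ≥ N, ∀ η τ : Fin k → Cantor,
    SimilarMod ℓ η τ → (θ.Realize (fun i => a (η i)) ↔ θ.Realize (fun i => a (τ i)))

/-- A family of `m`-tuples indexed by `2^ω` is asymptotically similar; here `θ` has `k` blocks
of `m` variables each. -/
def AsymptoticallySimilarTuples {m : ℕ} (a : Cantor → Fin m → M) : Prop :=
  ∀ (k : ℕ) (θ : L.Formula (Fin k × Fin m)), ∃ N : ℕ, ∀ ℓ ≥ N, ∀ η τ : Fin k → Cantor,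
    SimilarMod ℓ η τ →
      (θ.Realize (fun p => a (η p.1) p.2) ↔ θ.Realize (fun p => a (τ p.1) p.2))

end Asymptotic

/-! ### The space `2^ω × ω` -/

/-- The space `2^ω × ω`, with its product topology (`ω` discrete) and product σ-algebra. -/
abbrev CantorOmega : Type := Cantor × ℕ

/-- The measure on `2^ω × ω` that gives `U_a × {i}` the mass `1 / 2^(n+i+1)` when `a` has length
`n`: the fair coin-tossing measure on `2^ω` times the measure on `ω` with mass `1 / 2^(i+1)`
at `i`. -/
noncomputable def cantorOmegaMeasure : Measure CantorOmega :=
  (Measure.infinitePi fun _ : ℕ => (PMF.uniformOfFintype Bool).toMeasure).prod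
    (Measure.sum fun i : ℕ => (2⁻¹ : ℝ≥0∞) ^ (i + 1) • Measure.dirac i)

/-- `D` is a finite Boolean combination of open sets. -/
def IsBooleanCombinationOfOpens {X : Type*} [TopologicalSpace X] (D : Set X) : Prop :=
  D ∈ BooleanSubalgebra.closure {U : Set X | IsOpen U}

/-! ### Splitting variables in a structure with trivial definable closure. -/

section TrivialDcl

variable {L : FirstOrder.Language.{u, v}} {M : Type w} [L.Structure M]

/-! The structure is built from finite approximations. A condition is a formula whose variables are
the nodes of height `ℓ` in `ω` many binary trees, realized in `M` by an injective labelling of these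
nodes. It constrains a labelling of the branches by asking that every choice of one branch through
each node satisfy the formula.

Trivial definable closure is what allows nodes to branch. A set that contains `m` and is definable
from parameters other than `m` is infinite, so each variable in use can receive a second, new value
with every mixture of old and new values still satisfying the formula (`DclTrivial.exists_split`).
Hence a condition passes to the next height (`Condition.exists_next`). At a fixed height it can be
strengthened to decide which member of a cover of `M^n` holds at given nodes, a further node serving
as witness (`Condition.exists_settledAt`).

Treating countably many requirements in this way gives labellings `s ℓ`
(`exists_labelling_sequence`), and a branch `x` becomes the class of `(s ℓ x)` in a nonprincipal
ultrapower of `M`. Henkin requirements turn the set of these classes into an elementary substructure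
(`exists_limit_structure`). The covers `{θ, ¬θ}` make the truth of `θ` at branches depend only on
their nodes at a large height (`IsLevelDetermined`); asymptotic similarity, the Boolean combinations
of open sets and positive measure all follow from this. The covers by complete formulas and by
negated members of the omitted types give atomicity and omission. -/

theorem FirstOrder.Language.Formula.realize_congr_of_eqOn {α : Type*} [DecidableEq α]
    (φ : L.Formula α) {s t : α → M} (h : ∀ x ∈ φ.freeVarFinset, s x = t x) :
    φ.Realize s ↔ φ.Realize t := by
  have hs := Language.BoundedFormula.realize_restrictFreeVar (M := M) (φ := φ) (f := id)
    (v := fun x => s x) (xs := default) s (by simp)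
  have ht := Language.BoundedFormula.realize_restrictFreeVar (M := M) (φ := φ) (f := id)
    (v := fun x => s x) (xs := default) t (fun x => h x x.2)
  exact hs.symm.trans ht

/-- If `T` were finite, its other elements could be removed by using them as parameters; this would
define `m` from the complement of `{m}`. -/
theorem DclTrivial.infinite_of_mem (hM : DclTrivial L M) {m : M} {T : Set M}
    (hT : ({m}ᶜ : Set M).Definable₁ L T) (hm : m ∈ T) : T.Infinite := by
  intro hfin
  have hdef : ∀ E : Set M, E.Finite → m ∉ E → ({m}ᶜ : Set M).Definable₁ L E := by
    intro E hE
    induction E, hE using Set.Finite.induction_on with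
    | empty => intro _; exact Set.definable_empty
    | @insert a E _ _ ih =>
      intro hmE
      have ha : a ∈ dcl L ({m}ᶜ : Set M) := by
        rw [hM]
        rintro rfl
        exact hmE (Set.mem_insert _ _)
      exact Set.Definable.union ha (ih fun h => hmE (Set.mem_insert_of_mem _ h))
  have h1 : ({m}ᶜ : Set M).Definable₁ L (T \ (T \ {m})) :=
    Set.Definable.sdiff hT (hdef _ (hfin.subset Set.sdiff_subset) (by simp))
  rw [Set.sdiff_sdiff_cancel_left (by simpa using hm)] at h1
  have : m ∈ dcl L ({m}ᶜ : Set M) := h1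
  rw [hM] at this
  exact this rfl

theorem DclTrivial.infinite [Nonempty M] (hM : DclTrivial L M) : Infinite M := by
  obtain ⟨m⟩ := ‹Nonempty M›
  exact Set.infinite_univ_iff.1 (hM.infinite_of_mem (m := m) Set.definable_univ (Set.mem_univ m))

theorem definable₁_update {α : Type*} [DecidableEq α] (φ : L.Formula α) (s : α → M) (a : α)
    {A : Set M} (hs : ∀ x, x ≠ a → s x ∈ A) :
    A.Definable₁ L {m | φ.Realize (Function.update s a m)} := by
  refine ⟨((L.lhomWithConstants A).onFormula φ).subst fun x =>
    if h : x = a then Language.Term.var 0 else (L.con ⟨s x, hs x h⟩).term, ?_⟩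
  ext v
  simp only [Set.mem_ofPred_eq, Language.Formula.Realize, Language.BoundedFormula.realize_subst]
  have : (fun x => Language.Term.realize v (if h : x = a then Language.Term.var 0 else
      (L.con (⟨s x, hs x h⟩ : A)).term : L[[A]].Term (Fin 1))) =
      Function.update s a (v 0) := by
    ext x
    by_cases h : x = a
    · subst h; simp
    · simp [h]
  rw [this]
  exact (Language.LHom.realize_onFormula (L.lhomWithConstants A) φ).symm

/-- Every variable from a finite set can be given a second value, in such a way that every mixture
of old and new values satisfies `φ`. -/
theorem DclTrivial.exists_split (hM : DclTrivial L M) {α : Type*} [DecidableEq α]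
    (φ : L.Formula α) {s : α → M} (hs : Function.Injective s) (hφ : φ.Realize s)
    (W G : Finset α) (hGW : G ⊆ W) :
    ∃ s' : α → M, (∀ B ⊆ G, φ.Realize (B.piecewise s' s)) ∧ Set.InjOn s' G ∧
      ∀ x ∈ G, ∀ y ∈ W, s' x ≠ s y := by
  classical
  induction G using Finset.induction_on with
  | empty =>
    refine ⟨s, ?_, by simp, by simp⟩
    intro B hB
    obtain rfl := Finset.subset_empty.1 hB
    simpa using hφ
  | insert a G ha ih =>
    obtain ⟨s', h1, h2, h3⟩ := ih fun x hx => hGW (Finset.mem_insert_of_mem hx)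
    have haW : a ∈ W := hGW (Finset.mem_insert_self a G)
    -- The candidates for the second value of `a`, required to fit all earlier mixtures at once. The
    -- old value `s a` is one of them and is not among the parameters, so there are infinitely many.
    have hT : {m | ∀ B ∈ G.powerset,
        φ.Realize (Function.update (B.piecewise s' s) a m)}.Infinite := by
      refine hM.infinite_of_mem (m := s a) ?_ ?_
      · have := Set.definable_biInter_finset (L := L) (A := ({s a}ᶜ : Set M))
          (f := fun B : Finset α => {x : Fin 1 → M |
            B ⊆ G → φ.Realize (Function.update (B.piecewise s' s) a (x 0))}) (fun B => by
            by_cases hB : B ⊆ G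
            · simp only [hB, true_imp_iff]
              refine definable₁_update φ _ a fun x hx => ?_
              by_cases hxB : x ∈ B
              · simpa [hxB] using h3 x (hB hxB) a haW
              · simpa [hxB] using fun h => hx (hs h)
            · simp only [hB, false_imp_iff]
              exact Set.definable_univ) G.powerset
        refine (congrArg (({s a}ᶜ : Set M).Definable L) ?_).mp this
        ext x
        simp only [Set.mem_iInter, Set.mem_ofPred_eq, Finset.mem_powerset]
        exact ⟨fun h B hB => h B hB hB, fun h B hB _ => h B hB⟩
      · intro B hB
        have haB : a ∉ B := fun h => ha (Finset.mem_powerset.1 hB h)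
        have : Function.update (B.piecewise s' s) a (s a) = B.piecewise s' s := by
          rw [Function.update_eq_self_iff]
          simp [haB]
        rw [this]
        exact h1 B (Finset.mem_powerset.1 hB)
    -- Avoiding these finitely many values preserves injectivity and disjointness from the old
    -- values.
    obtain ⟨m, hmT, hm⟩ := hT.exists_notMem_finset (W.image s ∪ G.image s')
    simp only [Finset.mem_union, Finset.mem_image, not_or, not_exists, not_and] at hm
    refine ⟨Function.update s' a m, ?_, ?_, ?_⟩
    · intro B hB
      have hBG : B.erase a ⊆ G := Finset.subset_insert_iff.1 hB
      by_cases haB : a ∈ B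
      · convert hmT (B.erase a) (Finset.mem_powerset.2 hBG) using 1
        ext x
        by_cases hx : x = a
        · subst hx; simp [haB]
        · by_cases hxB : x ∈ B <;> simp [hx, hxB]
      · rw [Finset.erase_eq_of_notMem haB] at hBG
        convert h1 B hBG using 1
        ext x
        by_cases hxB : x ∈ B
        · have hx : x ≠ a := fun h => haB (h ▸ hxB)
          simp [hx, hxB]
        · simp [hxB]
    · intro x hx y hy hxy
      by_cases hxa : x = a <;> by_cases hya : y = a
      · rw [hxa, hya]
      · subst hxa
        have hyG : y ∈ G := (Finset.mem_insert.1 hy).resolve_left hya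
        simp only [Function.update_self, Function.update_of_ne hya] at hxy
        exact absurd hxy.symm (hm.2 y hyG)
      · subst hya
        have hxG : x ∈ G := (Finset.mem_insert.1 hx).resolve_left hxa
        simp only [Function.update_self, Function.update_of_ne hxa] at hxy
        exact absurd hxy (hm.2 x hxG)
      · simp only [Function.update_of_ne hxa, Function.update_of_ne hya] at hxy
        exact h2 ((Finset.mem_insert.1 hx).resolve_left hxa)
          ((Finset.mem_insert.1 hy).resolve_left hya) hxy
    · intro x hx y hy
      by_cases hxa : x = a
      · subst hxa
        simpa using fun h => hm.1 y hy h.symm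
      · simpa [hxa] using h3 x ((Finset.mem_insert.1 hx).resolve_left hxa) y hy

theorem exists_injective_extension {α M : Type*} [Countable α] [Infinite M] (F : Finset α)
    (t : α → M) (ht : Set.InjOn t F) :
    ∃ t' : α → M, Function.Injective t' ∧ ∀ x ∈ F, t' x = t x := by
  classical
  have : Infinite ((F.image t : Finset M) : Set M)ᶜ.Elem :=
    ((F.image t).finite_toSet.infinite_compl).to_subtype
  obtain ⟨e, he⟩ := exists_injective_nat α
  let g := Infinite.natEmbedding ((F.image t : Finset M) : Set M)ᶜ.Elem
  have hg : ∀ n x, x ∈ F → (g n : M) ≠ t x := fun n x hx h =>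
    (g n).2 (by simpa using ⟨x, hx, h.symm⟩)
  refine ⟨fun x => if x ∈ F then t x else g (e x), ?_, fun x hx => by simp [hx]⟩
  intro x y hxy
  by_cases hx : x ∈ F <;> by_cases hy : y ∈ F <;> simp only [hx, hy, if_true, if_false] at hxy
  · exact ht hx hy hxy
  · exact absurd hxy.symm (hg _ _ hx)
  · exact absurd hxy (hg _ _ hy)
  · exact he (g.injective (Subtype.ext hxy))

end TrivialDcl

/-! ### Trees, conditions and requirements. -/

section Conditions

/-- The nodes of height `ℓ` of the `ω` many binary trees whose branches form `CantorOmega`. -/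
abbrev Level (ℓ : ℕ) : Type := (Fin ℓ → Bool) × ℕ

/-- The node of height `ℓ` on a branch. -/
def levelMap (ℓ : ℕ) (x : CantorOmega) : Level ℓ := (restr ℓ x.1, x.2)

/-- A branch through a node. -/
def levelLift (ℓ : ℕ) (y : Level ℓ) : CantorOmega :=
  (fun j => if h : j < ℓ then y.1 ⟨j, h⟩ else false, y.2)

@[simp] theorem levelMap_levelLift {ℓ : ℕ} (y : Level ℓ) : levelMap ℓ (levelLift ℓ y) = y := by
  ext <;> simp [levelMap, levelLift, restr]

theorem eventually_levelMap_ne {x y : CantorOmega} (h : x ≠ y) :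
    ∃ N, ∀ ℓ ≥ N, levelMap ℓ x ≠ levelMap ℓ y := by
  by_cases h2 : x.2 = y.2
  · have h1 : x.1 ≠ y.1 := fun h1 => h (Prod.ext h1 h2)
    obtain ⟨j, hj⟩ := Function.ne_iff.1 h1
    refine ⟨j + 1, fun ℓ hℓ heq => hj ?_⟩
    exact congrFun (congrArg Prod.fst heq) ⟨j, hℓ⟩
  · exact ⟨0, fun ℓ _ heq => h2 (Prod.ext_iff.1 heq).2⟩

/-- The tuple `u` has distinct nodes of height `ℓ` at distinct entries. -/
def LevelSplits (ℓ : ℕ) {α : Type*} (u : α → CantorOmega) : Prop :=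
  ∀ i j, levelMap ℓ (u i) = levelMap ℓ (u j) → u i = u j

theorem exists_levelSplits {α : Type*} [Finite α] (u : α → CantorOmega) :
    ∃ N, ∀ ℓ ≥ N, LevelSplits ℓ u ∧ ∀ i, (u i).2 < ℓ := by
  have h : ∀ i j, ∃ N, u i ≠ u j → ∀ ℓ ≥ N, levelMap ℓ (u i) ≠ levelMap ℓ (u j) := by
    intro i j
    by_cases hij : u i = u j
    · exact ⟨0, fun h => absurd hij h⟩
    · obtain ⟨N, hN⟩ := eventually_levelMap_ne hij
      exact ⟨N, fun _ => hN⟩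
  choose N hN using h
  obtain ⟨K, hK⟩ := (Set.finite_range fun p : α × α => N p.1 p.2).bddAbove
  obtain ⟨K', hK'⟩ := (Set.finite_range fun i => (u i).2).bddAbove
  refine ⟨max K (K' + 1), fun ℓ hℓ => ⟨fun i j hij => ?_, fun i => ?_⟩⟩
  · by_contra hne
    exact hN i j hne ℓ ((hK ⟨(i, j), rfl⟩).trans ((le_max_left _ _).trans hℓ)) hij
  · exact (Nat.lt_succ_of_le (hK' ⟨i, rfl⟩)).trans_le ((le_max_right _ _).trans hℓ)

variable (L : FirstOrder.Language.{u, v}) (M : Type w) [L.Structure M]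

/-- A consistent finite piece of information about the nodes of some height. -/
structure Condition where
  level : ℕ
  formula : L.Formula (Level level)
  exists_injective : ∃ s : Level level → M, Function.Injective s ∧ formula.Realize s

/-- A requirement on `n`-tuples: one of the formulas must hold, for some value of the additional
last variable. -/
structure Requirement where
  arity : ℕ
  formulas : Set (L.Formula (Fin (arity + 1)))
  covers : ∀ a : Fin arity → M, ∃ D ∈ formulas, ∃ b : M, D.Realize (Fin.snoc a b : _ → M)

variable {L M}

/-- The labellings of branches for which every transversal of the nodes satisfies the formula. -/
def Condition.labellings (p : Condition L M) : Set (CantorOmega → M) :=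
  {s | ∀ f : Level p.level → CantorOmega, (∀ x, levelMap p.level (f x) = x) →
    p.formula.Realize (s ∘ f)}

/-- A set of labellings settles which formula of the requirement `R` holds at the nodes `g`. -/
def Requirement.SettledAt (R : Requirement L M) {ℓ : ℕ} (g : Fin R.arity → Level ℓ)
    (S : Set (CantorOmega → M)) : Prop :=
  ∃ D ∈ R.formulas, ∃ h : Level ℓ, ∀ s ∈ S, ∀ u : Fin (R.arity + 1) → CantorOmega,
    LevelSplits ℓ u → levelMap ℓ ∘ u = (Fin.snoc g h : Fin (R.arity + 1) → Level ℓ) →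
      D.Realize (s ∘ u)

theorem Requirement.SettledAt.mono {R : Requirement L M} {ℓ : ℕ} {g : Fin R.arity → Level ℓ}
    {S S' : Set (CantorOmega → M)} (hS : S' ⊆ S) (h : R.SettledAt g S) : R.SettledAt g S' := by
  obtain ⟨D, hD, x, hx⟩ := h
  exact ⟨D, hD, x, fun s hs => hx s (hS hs)⟩

theorem exists_section {ℓ : ℕ} {n : ℕ} (u : Fin n → CantorOmega) (hu : LevelSplits ℓ u) :
    ∃ f : Level ℓ → CantorOmega, (∀ x, levelMap ℓ (f x) = x) ∧ ∀ i, f (levelMap ℓ (u i)) = u i := by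
  classical
  refine ⟨fun x => if h : ∃ i, levelMap ℓ (u i) = x then u h.choose else levelLift ℓ x, ?_, ?_⟩
  · intro x
    by_cases h : ∃ i, levelMap ℓ (u i) = x
    · simp only [h, dif_pos]
      exact h.choose_spec
    · simp [h]
  · intro i
    have h : ∃ j, levelMap ℓ (u j) = levelMap ℓ (u i) := ⟨i, rfl⟩
    simp only [h, dif_pos]
    exact hu _ _ h.choose_spec

/-- An injective realization of the condition's formula already selects a formula `D` of the
requirement and a witness `b`; conjoining `D` at the corresponding nodes keeps the condition
consistent. -/
theorem Condition.exists_settledAt (p : Condition L M) (R : Requirement L M)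
    (g : Fin R.arity → Level p.level) :
    ∃ q : Condition L M, q.level = p.level ∧ q.labellings ⊆ p.labellings ∧
      R.SettledAt g q.labellings := by
  classical
  obtain ⟨ℓ, φ, s, hs, hφ⟩ := p
  dsimp only at g
  obtain ⟨D, hD, b, hb⟩ := R.covers (s ∘ g)
  have key : ∃ (h : Level ℓ) (s' : Level ℓ → M), Function.Injective s' ∧ φ.Realize s' ∧
      D.Realize (s' ∘ (Fin.snoc g h : Fin (R.arity + 1) → Level ℓ)) := by
    -- If `b` labels no node, it becomes the label of a node occurring neither in `φ` nor in `g`.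
    -- Such a node exists since there are infinitely many trees.
    by_cases hbs : ∃ h, s h = b
    · obtain ⟨h, rfl⟩ := hbs
      refine ⟨h, s, hs, hφ, ?_⟩
      rwa [Fin.comp_snoc]
    · obtain ⟨h, hh⟩ := Infinite.exists_notMem_finset (φ.freeVarFinset ∪ Finset.univ.image g)
      simp only [Finset.mem_union, Finset.mem_image, Finset.mem_univ, true_and, not_or,
        not_exists] at hh
      refine ⟨h, Function.update s h b, ?_, ?_, ?_⟩
      · intro x y hxy
        by_cases hx : x = h <;> by_cases hy : y = h
        · rw [hx, hy]
        · subst hx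
          simp only [Function.update_self, Function.update_of_ne hy] at hxy
          exact absurd ⟨y, hxy.symm⟩ hbs
        · subst hy
          simp only [Function.update_self, Function.update_of_ne hx] at hxy
          exact absurd ⟨x, hxy⟩ hbs
        · simp only [Function.update_of_ne hx, Function.update_of_ne hy] at hxy
          exact hs hxy
      · refine (φ.realize_congr_of_eqOn fun x hx => ?_).1 hφ
        have : x ≠ h := fun h' => hh.1 (h' ▸ hx)
        simp [this]
      · rw [Fin.comp_snoc]
        convert hb using 2
        · ext i
          simp [hh.2 i]
        · simp
  obtain ⟨h, s', hs', hφ', hDs'⟩ := key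
  refine ⟨⟨ℓ, φ ⊓ D.relabel (Fin.snoc g h : Fin (R.arity + 1) → Level ℓ), s', hs', ?_⟩, rfl, ?_, ?_⟩
  · rw [Language.Formula.realize_inf, Language.Formula.realize_relabel]
    exact ⟨hφ', hDs'⟩
  · intro t ht f hf
    exact (Language.Formula.realize_inf.1 (ht f hf)).1
  · refine ⟨D, hD, h, fun t ht u hu hug => ?_⟩
    obtain ⟨f, hf, hfu⟩ := exists_section u hu
    have h2 := (Language.Formula.realize_inf.1 (ht f hf)).2
    rw [Language.Formula.realize_relabel] at h2
    convert h2 using 1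
    ext i
    have := congrFun hug i
    simp only [Function.comp_apply] at this ⊢
    rw [← hfu i, this]

/-- The new formula asserts the old one for every choice of a child of each node that occurs in it;
splitting makes this finite conjunction consistent. -/
theorem Condition.exists_next (hM : DclTrivial L M) [Nonempty M] (p : Condition L M) :
    ∃ q : Condition L M, q.level = p.level + 1 ∧ q.labellings ⊆ p.labellings := by
  classical
  have := hM.infinite
  obtain ⟨ℓ, φ, s, hs, hφ⟩ := p
  let F := φ.freeVarFinset
  obtain ⟨s', h1, h2, h3⟩ := hM.exists_split φ hs hφ F F subset_rfl
  let e : Finset (Level ℓ) → Level ℓ → Level (ℓ + 1) := fun B x =>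
    (Fin.snoc x.1 (decide (x ∈ B)), x.2)
  let drop : Level (ℓ + 1) → Level ℓ := fun y => (Fin.init y.1, y.2)
  have hde : ∀ B x, drop (e B x) = x := fun B x => by simp [drop, e]
  -- The left child keeps the old label and the right child takes the split value. Only `F'`, the
  -- children of nodes in `F`, matters; elsewhere the labels are replaced to obtain injectivity.
  let t : Level (ℓ + 1) → M := fun y => if y.1 (Fin.last ℓ) then s' (drop y) else s (drop y)
  let F' : Finset (Level (ℓ + 1)) := F.image (e F) ∪ F.image (e ∅)
  have hF' : ∀ B, ∀ x ∈ F, e B x ∈ F' := by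
    intro B x hx
    by_cases hxB : x ∈ B
    · refine Finset.mem_union_left _ (Finset.mem_image.2 ⟨x, hx, ?_⟩)
      simp [e, hxB, hx]
    · refine Finset.mem_union_right _ (Finset.mem_image.2 ⟨x, hx, ?_⟩)
      simp [e, hxB]
  have hdF : ∀ y ∈ F', drop y ∈ F := by
    intro y hy
    rcases Finset.mem_union.1 hy with hy | hy <;>
    · obtain ⟨x, hx, rfl⟩ := Finset.mem_image.1 hy
      rwa [hde]
  have hext : ∀ y z : Level (ℓ + 1), y.1 (Fin.last ℓ) = z.1 (Fin.last ℓ) → drop y = drop z →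
      y = z := by
    intro y z hyz hd
    simp only [drop, Prod.mk.injEq] at hd
    refine Prod.ext ?_ hd.2
    rw [← Fin.snoc_init_self y.1, ← Fin.snoc_init_self z.1, hyz, hd.1]
  have ht : Set.InjOn t F' := by
    intro y hy z hz hyz
    have hy' := hdF y hy
    have hz' := hdF z hz
    by_cases hyl : y.1 (Fin.last ℓ) <;> by_cases hzl : z.1 (Fin.last ℓ) <;>
      simp only [t, hyl, hzl, if_true, if_false, Bool.false_eq_true] at hyz
    · exact hext y z (hyl.trans hzl.symm) (h2 hy' hz' hyz)
    · exact absurd hyz (h3 _ hy' _ hz')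
    · exact absurd hyz.symm (h3 _ hz' _ hy')
    · exact hext y z (by simp_all) (hs hyz)
  obtain ⟨t', ht', htt'⟩ := exists_injective_extension F' t ht
  let ψ : L.Formula (Level (ℓ + 1)) :=
    Language.Formula.iInf fun B : F.powerset => φ.relabel (e B)
  have hψ : ∀ r : Level (ℓ + 1) → M, ψ.Realize r ↔ ∀ B ⊆ F, φ.Realize (r ∘ e B) := by
    intro r
    simp only [ψ, Language.Formula.realize_iInf, Language.Formula.realize_relabel]
    exact ⟨fun h B hB => h ⟨B, Finset.mem_powerset.2 hB⟩,
      fun h B => h B (Finset.mem_powerset.1 B.2)⟩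
  refine ⟨⟨ℓ + 1, ψ, t', ht', (hψ t').2 fun B hB => ?_⟩, rfl, ?_⟩
  · refine (φ.realize_congr_of_eqOn fun x hx => ?_).1 (h1 B hB)
    rw [Function.comp_apply, htt' _ (hF' B x hx)]
    by_cases hxB : x ∈ B <;> simp [t, hxB, e, drop]
  · intro r hr f hf
    -- The nodes of `F` at which the transversal `f` turns right: this selects the conjunct that
    -- applies to `f`.
    let B : Finset (Level ℓ) := F.filter fun x => (f x).1 ℓ = true
    have hfe : ∀ x ∈ F, levelMap (ℓ + 1) (f x) = e B x := by
      intro x hx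
      refine hext _ _ ?_ ?_
      · simp only [levelMap, restr, Fin.val_last, e, Fin.snoc_last, B, Finset.mem_filter, hx,
          true_and]
        simp
      · rw [hde, ← hf x]
        simp only [hf x]
        exact hf x
    -- A transversal of height `ℓ + 1` that follows `f` wherever `f` passes.
    let g : Level (ℓ + 1) → CantorOmega := fun y =>
      if levelMap (ℓ + 1) (f (drop y)) = y then f (drop y) else levelLift (ℓ + 1) y
    have hg : ∀ y, levelMap (ℓ + 1) (g y) = y := by
      intro y
      by_cases hy : levelMap (ℓ + 1) (f (drop y)) = y
      · simp only [g, hy, if_true]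
      · simp only [g, hy, if_false, levelMap_levelLift]
    have hrg := (hψ _).1 (hr g hg) B (Finset.filter_subset _ _)
    refine (φ.realize_congr_of_eqOn fun x hx => ?_).1 hrg
    simp only [Function.comp_apply, g, hde, hfe x hx, if_true]

theorem Condition.exists_next_settled (hM : DclTrivial L M) [Nonempty M]
    (R : ℕ → Requirement L M) (p : Condition L M) :
    ∃ q : Condition L M, q.level = p.level + 1 ∧ q.labellings ⊆ p.labellings ∧
      ∀ i < q.level, ∀ g : Fin (R i).arity → Level q.level, (∀ j, (g j).2 < q.level) →
        (R i).SettledAt g q.labellings := by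
  obtain ⟨q₀, hq₀, hpq₀⟩ := p.exists_next hM
  obtain ⟨ℓ, hℓ⟩ : ∃ ℓ, ℓ = p.level + 1 := ⟨_, rfl⟩
  rw [← hℓ] at hq₀ ⊢
  -- Bounding both the requirement index and the tree index by `ℓ` leaves finitely many tasks,
  -- treated one at a time.
  let T := Σ i : Fin ℓ, Fin (R i).arity → (Fin ℓ → Bool) × Fin ℓ
  let node : (x : T) → Fin (R x.1).arity → Level ℓ := fun x j => ((x.2 j).1, (x.2 j).2)
  have key : ∀ F : Finset T, ∃ q : Condition L M, q.level = ℓ ∧ q.labellings ⊆ p.labellings ∧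
      ∀ x ∈ F, (R x.1).SettledAt (node x) q.labellings := by
    classical
    intro F
    induction F using Finset.induction_on with
    | empty => exact ⟨q₀, hq₀, hpq₀, by simp⟩
    | insert x F _ ih =>
      obtain ⟨q, rfl, hqp, hq⟩ := ih
      obtain ⟨q', hq', hq'q, hset⟩ := q.exists_settledAt (R x.1) (node x)
      refine ⟨q', hq', hq'q.trans hqp, fun y hy => ?_⟩
      rcases Finset.mem_insert.1 hy with rfl | hy
      · exact hset
      · exact (hq y hy).mono hq'q
  obtain ⟨q, rfl, hqp, hq⟩ := key Finset.univ
  refine ⟨q, rfl, hqp, fun i hi g hg => ?_⟩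
  exact hq ⟨⟨i, hi⟩, fun j => ((g j).1, ⟨(g j).2, hg j⟩)⟩ (Finset.mem_univ _)

/-- A sequence of labellings of the branches that meets countably many requirements. -/
theorem exists_labelling_sequence (hM : DclTrivial L M) [Nonempty M]
    (R : ℕ → Requirement L M) :
    ∃ s : ℕ → CantorOmega → M,
      (∀ ℓ x y, s ℓ x = s ℓ y → levelMap ℓ x = levelMap ℓ y) ∧
      ∀ i, ∀ ℓ > i, ∀ g : Fin (R i).arity → Level ℓ, (∀ j, (g j).2 < ℓ) →
        (R i).SettledAt g (s '' Set.Ici ℓ) := by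
  have := hM.infinite
  choose next hlevel hsub hset using fun p : Condition L M => p.exists_next_settled hM R
  obtain ⟨e, he⟩ := exists_injective_nat (Level 0)
  let p₀ : Condition L M := ⟨0, ⊤, fun x => Infinite.natEmbedding M (e x),
    (Infinite.natEmbedding M).injective.comp he, Language.Formula.realize_top.2 trivial⟩
  let p : ℕ → Condition L M := fun ℓ => Nat.rec p₀ (fun _ q => next q) ℓ
  have hp : ∀ ℓ, (p ℓ).level = ℓ := by
    intro ℓ
    induction ℓ with
    | zero => rfl
    | succ ℓ ih => exact (hlevel (p ℓ)).trans (congrArg (· + 1) ih)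
  have hanti : Antitone fun ℓ => (p ℓ).labellings := antitone_nat_of_succ_le fun ℓ => hsub (p ℓ)
  -- Label each branch by the label of its node of height `ℓ`: every transversal then reproduces the
  -- injective realization.
  have hs : ∀ ℓ, ∃ s ∈ (p ℓ).labellings, ∀ x y, s x = s y → levelMap ℓ x = levelMap ℓ y := by
    intro ℓ
    obtain ⟨t, ht, htr⟩ := (p ℓ).exists_injective
    refine ⟨t ∘ levelMap (p ℓ).level, fun f hf => ?_, fun x y hxy => ?_⟩
    · convert htr using 1
      ext x
      simp [hf]
    · have := ht hxy
      rwa [hp] at this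
  choose s hs hinj using hs
  refine ⟨s, hinj, fun i ℓ hi g hg => ?_⟩
  have hsub' : s '' Set.Ici ℓ ⊆ (p ℓ).labellings := by
    rintro _ ⟨ℓ', hℓ', rfl⟩
    exact hanti hℓ' (hs ℓ')
  refine Requirement.SettledAt.mono hsub' ?_
  -- The initial condition settles nothing; `ℓ > i` ensures that `p ℓ` comes from an extension step.
  obtain ⟨k, rfl⟩ : ∃ k, ℓ = k + 1 := ⟨ℓ - 1, by omega⟩
  have h := hset (p k)
  have hk : (next (p k)).level = k + 1 := hp (k + 1)
  change (R i).SettledAt g (next (p k)).labellings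
  generalize next (p k) = q at h hk
  have aux : ∀ ℓ, q.level = ℓ → i < ℓ → ∀ g : Fin (R i).arity → Level ℓ, (∀ j, (g j).2 < ℓ) →
      (R i).SettledAt g q.labellings := by
    rintro _ rfl hi
    exact h i hi
  exact aux _ hk hi g hg

end Conditions

/-! ### Henkin witnesses and the limit inside an ultrapower. -/

section LimitStructure

variable {L : FirstOrder.Language.{u, v}} {M : Type w} [L.Structure M]

theorem snoc_comp_apply {A B : Type*} {n : ℕ} (s : A → B) (v : Fin n → A) (w : A) :
    s ∘ (Fin.snoc v w : Fin (n + 1) → A) = (Fin.snoc (s ∘ v) (s w) : Fin (n + 1) → B) :=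
  Fin.comp_snoc s v w

/-- When `h` is already the node of an entry of `v`, that entry itself must be repeated; a section
through `v` makes this choice automatically. -/
theorem LevelSplits.exists_snoc {ℓ n : ℕ} {v : Fin n → CantorOmega} (hv : LevelSplits ℓ v)
    (h : Level ℓ) : ∃ w, LevelSplits ℓ (Fin.snoc v w : Fin (n + 1) → CantorOmega) ∧
      levelMap ℓ ∘ (Fin.snoc v w : Fin (n + 1) → CantorOmega) =
        (Fin.snoc (levelMap ℓ ∘ v) h : Fin (n + 1) → Level ℓ) := by
  obtain ⟨f, hf, hfv⟩ := exists_section v hv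
  refine ⟨f h, ?_, ?_⟩
  · have : (Fin.snoc v (f h) : Fin (n + 1) → CantorOmega) =
        f ∘ (Fin.snoc (levelMap ℓ ∘ v) h : Fin (n + 1) → Level ℓ) := by
      rw [snoc_comp_apply]
      congr 1
      ext1 i
      simp [hfv]
    intro i j hij
    rw [this] at hij ⊢
    simp only [Function.comp_apply, hf] at hij ⊢
    rw [hij]
  · rw [snoc_comp_apply, hf]

/-- A settled requirement holds in the limit at every tuple of branches. -/
theorem Requirement.eventually_of_settledAt {s : ℕ → CantorOmega → M} (R : Requirement L M)
    (hset : ∃ N, ∀ ℓ > N, ∀ g : Fin R.arity → Level ℓ, (∀ j, (g j).2 < ℓ) →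
      R.SettledAt g (s '' Set.Ici ℓ)) (v : Fin R.arity → CantorOmega) :
    ∃ D ∈ R.formulas, ∃ w, ∃ N, ∀ ℓ ≥ N,
      D.Realize (s ℓ ∘ (Fin.snoc v w : Fin (R.arity + 1) → CantorOmega)) := by
  obtain ⟨N, hN⟩ := hset
  obtain ⟨K, hK⟩ := exists_levelSplits v
  obtain ⟨ℓ, hNℓ, hKℓ⟩ : ∃ ℓ, ℓ > N ∧ ℓ ≥ K := ⟨max K (N + 1), by omega, by omega⟩
  obtain ⟨hsplit, hslice⟩ := hK ℓ hKℓ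
  obtain ⟨D, hD, h, hh⟩ := hN ℓ hNℓ (levelMap ℓ ∘ v) hslice
  obtain ⟨w, hw, hwv⟩ := hsplit.exists_snoc h
  exact ⟨D, hD, w, ℓ, fun ℓ' hℓ' => hh _ ⟨ℓ', hℓ', rfl⟩ _ hw hwv⟩

/-- Existential quantification over the last variable. -/
noncomputable def existsLast {n : ℕ} (θ : L.Formula (Fin (n + 1))) : L.Formula (Fin n) :=
  (θ.relabel (Fin.lastCases (Sum.inr ()) Sum.inl : Fin (n + 1) → Fin n ⊕ Unit)).iExs Unit

theorem realize_existsLast {n : ℕ} (θ : L.Formula (Fin (n + 1))) (a : Fin n → M) :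
    (existsLast θ).Realize a ↔ ∃ b, θ.Realize (Fin.snoc a b : Fin (n + 1) → M) := by
  have h : ∀ b : Unit → M, Sum.elim a b ∘
      (Fin.lastCases (Sum.inr ()) Sum.inl : Fin (n + 1) → Fin n ⊕ Unit) =
        (Fin.snoc a (b ()) : Fin (n + 1) → M) := by
    intro b
    ext i
    refine Fin.lastCases ?_ (fun i => ?_) i <;> simp
  simp only [existsLast, Language.Formula.realize_iExs, Language.Formula.realize_relabel, h]
  exact ⟨fun ⟨b, hb⟩ => ⟨b (), hb⟩, fun ⟨b, hb⟩ => ⟨fun _ => b, hb⟩⟩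

theorem realize_relabel_castSucc {n : ℕ} (θ : L.Formula (Fin n)) (a : Fin n → M) (b : M) :
    (θ.relabel Fin.castSucc).Realize (Fin.snoc a b : Fin (n + 1) → M) ↔ θ.Realize a := by
  rw [Language.Formula.realize_relabel]
  refine iff_of_eq (congrArg _ (funext fun i => ?_))
  simp

/-- The requirement that an existential formula have a witness. -/
noncomputable def henkinRequirement [Nonempty M] {n : ℕ} (θ : L.Formula (Fin (n + 1))) :
    Requirement L M where
  arity := n
  formulas := {((existsLast θ).relabel Fin.castSucc).imp θ}
  covers a := by
    refine ⟨_, rfl, ?_⟩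
    simp only [Language.Formula.realize_imp, realize_relabel_castSucc, realize_existsLast]
    by_cases h : ∃ b : M, θ.Realize (Fin.snoc a b : Fin (n + 1) → M)
    · obtain ⟨b, hb⟩ := h
      exact ⟨b, fun _ => hb⟩
    · exact ⟨Classical.arbitrary M, fun h' => absurd h' h⟩

theorem exists_witness_of_settledAt [Nonempty M] {s : ℕ → CantorOmega → M} {n : ℕ}
    (θ : L.Formula (Fin (n + 1)))
    (hset : ∃ N, ∀ ℓ > N, ∀ g : Fin n → Level ℓ, (∀ j, (g j).2 < ℓ) →
      (henkinRequirement (M := M) θ).SettledAt g (s '' Set.Ici ℓ)) (v : Fin n → CantorOmega) :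
    ∃ w, ∃ N, ∀ ℓ ≥ N, (∃ b, θ.Realize (Fin.snoc (s ℓ ∘ v) b : Fin (n + 1) → M)) →
      θ.Realize (Fin.snoc (s ℓ ∘ v) (s ℓ w) : Fin (n + 1) → M) := by
  obtain ⟨D, hD, w, N, hN⟩ := (henkinRequirement (M := M) θ).eventually_of_settledAt hset v
  have hN' : ∀ ℓ ≥ N, (((existsLast θ).relabel Fin.castSucc).imp θ).Realize
      (s ℓ ∘ (Fin.snoc v w : Fin (n + 1) → CantorOmega)) := by
    obtain rfl := hD
    exact hN
  refine ⟨w, N, fun ℓ hℓ hb => ?_⟩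
  have h := hN' ℓ hℓ
  rw [snoc_comp_apply, Language.Formula.realize_imp, realize_relabel_castSucc,
    realize_existsLast] at h
  exact h hb

/-- The limit of a sequence of labellings, as an elementary substructure of an ultrapower. -/
theorem exists_limit_structure [Nonempty M] (s : ℕ → CantorOmega → M)
    (hinj : ∀ ℓ x y, s ℓ x = s ℓ y → levelMap ℓ x = levelMap ℓ y)
    (hwit : ∀ (n : ℕ) (θ : L.Formula (Fin (n + 1))) (v : Fin n → CantorOmega),
      ∃ w, ∃ N, ∀ ℓ ≥ N, (∃ b, θ.Realize (Fin.snoc (s ℓ ∘ v) b : Fin (n + 1) → M)) →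
        θ.Realize (Fin.snoc (s ℓ ∘ v) (s ℓ w) : Fin (n + 1) → M)) :
    ∃ _ : L.Structure CantorOmega, ∀ (α : Type) (φ : L.Formula α) (v : α → CantorOmega),
      (∃ N, ∀ ℓ ≥ N, φ.Realize (s ℓ ∘ v)) → φ.Realize v := by
  let U : Ultrafilter ℕ := Filter.hyperfilter ℕ
  have hU : ∀ {P : ℕ → Prop}, (∃ N, ∀ ℓ ≥ N, P ℓ) → ∀ᶠ ℓ in (U : Filter ℕ), P ℓ := by
    intro P hP
    have : ∀ᶠ ℓ in Filter.atTop, P ℓ := Filter.eventually_atTop.2 hP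
    rw [← Nat.cofinite_eq_atTop] at this
    exact Filter.hyperfilter_le_cofinite this
  let mk : (ℕ → M) → (U : Filter ℕ).Product fun _ => M := fun a => (a : (U : Filter ℕ).Product _)
  have hmk : Function.Surjective mk := Quotient.mk_surjective
  let F : CantorOmega → (U : Filter ℕ).Product fun _ => M := fun x => mk fun ℓ => s ℓ x
  have hlos : ∀ {α : Type} (φ : L.Formula α) (x : α → ℕ → M),
      φ.Realize (fun i => mk (x i)) ↔ ∀ᶠ ℓ in (U : Filter ℕ), φ.Realize fun i => x i ℓ :=
    fun φ x => Language.Ultraproduct.realize_formula_cast φ x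
  have hF : Function.Injective F := by
    intro x y hxy
    by_contra hne
    obtain ⟨N, hN⟩ := eventually_levelMap_ne hne
    have h1 : ∀ᶠ ℓ in (U : Filter ℕ), s ℓ x = s ℓ y := Quotient.exact hxy
    obtain ⟨ℓ, hℓ, hℓ'⟩ := (h1.and (hU ⟨N, fun ℓ hℓ => hN ℓ hℓ⟩)).exists
    exact hℓ' (hinj ℓ x y hℓ)
  -- The Tarski–Vaught test for the range of `F`: by Łoś, a witness in the ultrapower gives
  -- witnesses in `M` for almost all `ℓ`, and then the branch `w` works.
  have hTV : ∀ (n : ℕ) (θ : L.Formula (Fin (n + 1))) (v : Fin n → CantorOmega)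
      (a : (U : Filter ℕ).Product fun _ => M), θ.Realize (Fin.snoc (F ∘ v) a : Fin (n + 1) → _) →
        ∃ w, θ.Realize (Fin.snoc (F ∘ v) (F w) : Fin (n + 1) → _) := by
    intro n θ v a ha
    obtain ⟨a, rfl⟩ := hmk a
    obtain ⟨w, hw⟩ := hwit n θ v
    have hsnoc : ∀ b : ℕ → M, (Fin.snoc (F ∘ v) (mk b) : Fin (n + 1) → _) =
        fun i => mk ((Fin.snoc (fun j ℓ => s ℓ (v j)) b : Fin (n + 1) → ℕ → M) i) := by
      intro b
      ext i
      refine Fin.lastCases ?_ (fun i => ?_) i <;> simp [F]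
    have hsnoc' : ∀ (b : ℕ → M) (ℓ : ℕ),
        (fun i => (Fin.snoc (fun j ℓ => s ℓ (v j)) b : Fin (n + 1) → ℕ → M) i ℓ) =
          (Fin.snoc (s ℓ ∘ v) (b ℓ) : Fin (n + 1) → M) := by
      intro b ℓ
      ext i
      refine Fin.lastCases ?_ (fun i => ?_) i <;> simp
    refine ⟨w, ?_⟩
    rw [hsnoc, hlos] at ha
    change θ.Realize (Fin.snoc (F ∘ v) (mk fun ℓ => s ℓ w) : Fin (n + 1) → _)
    rw [hsnoc, hlos]
    filter_upwards [ha, hU hw] with ℓ h1 h2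
    rw [hsnoc'] at h1 ⊢
    exact h2 ⟨_, h1⟩
  let S : L.Substructure ((U : Filter ℕ).Product fun _ => M) :=
    { carrier := Set.range F
      fun_mem := by
        intro n f x hx
        choose v hv using hx
        -- The graph of `f` as a formula, so that closure under `f` is an instance of `hTV`.
        let θ : L.Formula (Fin (n + 1)) := Language.Term.equal
          (Language.Term.func f fun i => Language.Term.var i.castSucc) (Language.Term.var (Fin.last n))
        have hθ : ∀ a, θ.Realize (Fin.snoc (F ∘ v) a : Fin (n + 1) → _) ↔
            Language.Structure.funMap f x = a := by
          intro a
          rw [Language.Formula.realize_equal]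
          simp [hv]
        obtain ⟨w, hw⟩ := hTV n θ v _ ((hθ _).2 rfl)
        exact ⟨w, ((hθ _).1 hw).symm⟩ }
  let E : L.ElementarySubstructure ((U : Filter ℕ).Product fun _ => M) :=
    S.toElementarySubstructure fun n φ x a ha => by
      let θ : L.Formula (Fin (n + 1)) := φ.toFormula.relabel (Sum.elim Empty.elim id)
      have hθ : ∀ z : Fin (n + 1) → (U : Filter ℕ).Product fun _ => M,
          θ.Realize z ↔ φ.Realize default z := by
        intro z
        rw [Language.Formula.realize_relabel, Language.BoundedFormula.realize_toFormula]
        exact iff_of_eq (congrArg₂ _ (Subsingleton.elim _ _) rfl)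
      choose v hv using fun i => (x i).2
      have hv' : ((↑) : S → _) ∘ x = F ∘ v := funext fun i => (hv i).symm
      rw [hv', ← hθ] at ha
      obtain ⟨w, hw⟩ := hTV n θ v a ha
      refine ⟨⟨F w, w, rfl⟩, ?_⟩
      rw [hv', ← hθ]
      exact hw
  let e : E ≃ CantorOmega := (Equiv.ofInjective F hF).symm
  let _ : L.Structure CantorOmega := e.inducedStructure
  let e' : E ≃[L] CantorOmega := e.inducedStructureEquiv
  refine ⟨inferInstance, fun α φ v hv => ?_⟩
  have h1 : φ.Realize (E.subtype ∘ (e'.symm ∘ v)) :=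
    (hlos φ fun i ℓ => s ℓ (v i)).2 (hU hv)
  rw [E.subtype.map_formula] at h1
  have h2 := (e'.toElementaryEmbedding.map_formula φ (e'.symm ∘ v)).2 h1
  convert h2 using 1
  ext1 i
  exact (e'.apply_symm_apply (v i)).symm

end LimitStructure

/-! ### Covers and level determination. -/

section CoverRequirements

variable {L : FirstOrder.Language.{u, v}} {M : Type w} [L.Structure M]

/-- The requirement that one of the formulas from a covering set hold. -/
noncomputable def coverRequirement [Nonempty M] {n : ℕ} (𝒟 : Set (L.Formula (Fin n)))
    (h𝒟 : ∀ a : Fin n → M, ∃ D ∈ 𝒟, D.Realize a) : Requirement L M where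
  arity := n
  formulas := Language.Formula.relabel Fin.castSucc '' 𝒟
  covers a := by
    obtain ⟨D, hD, hDa⟩ := h𝒟 a
    exact ⟨_, ⟨D, hD, rfl⟩, Classical.arbitrary M, (realize_relabel_castSucc D a _).2 hDa⟩

theorem realize_of_coverRequirement_settledAt [Nonempty M] {s : ℕ → CantorOmega → M} {n : ℕ}
    {𝒟 : Set (L.Formula (Fin n))} {h𝒟 : ∀ a : Fin n → M, ∃ D ∈ 𝒟, D.Realize a} {ℓ : ℕ}
    {g : Fin n → Level ℓ} (hset : (coverRequirement 𝒟 h𝒟).SettledAt g (s '' Set.Ici ℓ)) :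
    ∃ D ∈ 𝒟, ∀ v : Fin n → CantorOmega, LevelSplits ℓ v → levelMap ℓ ∘ v = g →
      ∀ ℓ' ≥ ℓ, D.Realize (s ℓ' ∘ v) := by
  obtain ⟨_, ⟨D, hD, rfl⟩, h, hh⟩ := hset
  refine ⟨D, hD, ?_⟩
  rintro v hv rfl ℓ' hℓ'
  obtain ⟨w, hw, hwv⟩ := hv.exists_snoc h
  have hr : (D.relabel Fin.castSucc).Realize
      (s ℓ' ∘ (Fin.snoc v w : Fin (n + 1) → CantorOmega)) := hh _ ⟨ℓ', hℓ', rfl⟩ _ hw hwv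
  rwa [snoc_comp_apply, realize_relabel_castSucc] at hr

/-- In an `L`-structure on `CantorOmega`, the truth of every formula at a tuple of branches is
determined by the nodes of sufficiently large height. -/
def IsLevelDetermined (L : FirstOrder.Language.{u, v}) [L.Structure CantorOmega] : Prop :=
  ∀ (n : ℕ) (θ : L.Formula (Fin n)), ∃ N, ∀ ℓ ≥ N, ∀ v v' : Fin n → CantorOmega,
    LevelSplits ℓ v → LevelSplits ℓ v' → levelMap ℓ ∘ v = levelMap ℓ ∘ v' →
      (∀ i, (v i).2 < ℓ) → (θ.Realize v ↔ θ.Realize v')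

/-- A structure with trivial definable closure has an elementarily equivalent structure on
`CantorOmega` that is level determined and respects countably many covers by formulas. -/
theorem exists_levelDetermined_structure [Countable L.Symbols] [Nonempty M]
    (hM : DclTrivial L M) {ι : Type} [Countable ι] (n : ι → ℕ)
    (𝒟 : ∀ i, Set (L.Formula (Fin (n i))))
    (h𝒟 : ∀ i (a : Fin (n i) → M), ∃ D ∈ 𝒟 i, D.Realize a) :
    ∃ _ : L.Structure CantorOmega, (M ≅[L] CantorOmega) ∧ IsLevelDetermined L ∧
      ∀ i (v : Fin (n i) → CantorOmega), ∃ D ∈ 𝒟 i, D.Realize v := by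
  let I := (Σ n, L.Formula (Fin (n + 1))) ⊕ (Σ n, L.Formula (Fin n)) ⊕ ι
  -- The covers `{θ, ¬θ}` are the source of level determination: the decision made at a tuple of
  -- nodes binds every splitting tuple of branches through them.
  have hdec : ∀ (θ : Σ n, L.Formula (Fin n)) (a : Fin θ.1 → M),
      ∃ D ∈ ({θ.2, θ.2.not} : Set (L.Formula (Fin θ.1))), D.Realize a := by
    intro θ a
    by_cases h : θ.2.Realize a
    · exact ⟨_, Or.inl rfl, h⟩
    · exact ⟨_, Or.inr rfl, Language.Formula.realize_not.2 h⟩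
  let Q : I → Requirement L M := Sum.elim (fun θ => henkinRequirement θ.2)
    (Sum.elim (fun θ => coverRequirement _ (hdec θ)) fun i => coverRequirement (𝒟 i) (h𝒟 i))
  have : Nonempty I := ⟨Sum.inl ⟨0, ⊤⟩⟩
  obtain ⟨enum, henum⟩ := exists_surjective_nat I
  obtain ⟨s, hinj, hs⟩ := exists_labelling_sequence hM (Q ∘ enum)
  have hset : ∀ i : I, ∃ N, ∀ ℓ > N, ∀ g : Fin (Q i).arity → Level ℓ, (∀ j, (g j).2 < ℓ) →
      (Q i).SettledAt g (s '' Set.Ici ℓ) := by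
    intro i
    obtain ⟨k, rfl⟩ := henum i
    exact ⟨k, hs k⟩
  obtain ⟨str, hstr⟩ := exists_limit_structure (L := L) s hinj fun n θ v =>
    exists_witness_of_settledAt θ (hset (Sum.inl ⟨n, θ⟩)) v
  have hcover : ∀ i (v : Fin (n i) → CantorOmega), ∃ D ∈ 𝒟 i, D.Realize v := by
    intro i v
    obtain ⟨N, hN⟩ := hset (Sum.inr (Sum.inr i))
    obtain ⟨K, hK⟩ := exists_levelSplits v
    obtain ⟨ℓ, hNℓ, hKℓ⟩ : ∃ ℓ, ℓ > N ∧ ℓ ≥ K := ⟨max K (N + 1), by omega, by omega⟩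
    obtain ⟨hsplit, hslice⟩ := hK ℓ hKℓ
    obtain ⟨D, hD, h⟩ :=
      realize_of_coverRequirement_settledAt (h𝒟 := h𝒟 i)
        (hN ℓ hNℓ (levelMap ℓ ∘ v) hslice)
    exact ⟨D, hD, hstr _ D v ⟨ℓ, h v hsplit rfl⟩⟩
  refine ⟨str, ?_, ?_, hcover⟩
  -- A sentence true in `M` holds at every stage `s ℓ`, so it passes to the limit; negation gives
  -- the converse.
  · have h : ∀ φ : L.Sentence, M ⊨ φ → CantorOmega ⊨ φ := by
      intro φ hφ
      have := hstr Empty φ default ⟨0, fun ℓ _ => ?_⟩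
      · exact (congrArg (Language.Formula.Realize φ) (Subsingleton.elim _ _)).mp this
      · rw [Subsingleton.elim (s ℓ ∘ default) default]
        exact hφ
    refine Language.elementarilyEquivalent_iff.2 fun φ => ⟨h φ, fun hφ => ?_⟩
    by_contra hn
    exact (Language.Sentence.realize_not CantorOmega).1
      (h φ.not ((Language.Sentence.realize_not M).2 hn)) hφ
  · intro n θ
    obtain ⟨N, hN⟩ := hset (Sum.inr (Sum.inl ⟨n, θ⟩))
    refine ⟨N + 1, fun ℓ hℓ v v' hv hv' hvv' hslice => ?_⟩
    obtain ⟨D, hD, h⟩ :=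
      realize_of_coverRequirement_settledAt (h𝒟 := hdec ⟨n, θ⟩)
        (hN ℓ hℓ (levelMap ℓ ∘ v) hslice)
    have h1 := hstr _ D v ⟨ℓ, h v hv rfl⟩
    have h2 := hstr _ D v' ⟨ℓ, h v' hv' hvv'.symm⟩
    rcases hD with hD | hD <;> rw [hD] at h1 h2
    · exact iff_of_true h1 h2
    · exact iff_of_false (Language.Formula.realize_not.1 h1) (Language.Formula.realize_not.1 h2)

end CoverRequirements

/-! ### Asymptotic similarity from level determination. -/

section LevelDetermined

variable {L : FirstOrder.Language.{u, v}} [L.Structure CantorOmega]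

theorem IsLevelDetermined.of_finite (hL : IsLevelDetermined L) {α : Type*} [Finite α]
    (θ : L.Formula α) : ∃ N, ∀ ℓ ≥ N, ∀ v v' : α → CantorOmega,
      LevelSplits ℓ v → LevelSplits ℓ v' → levelMap ℓ ∘ v = levelMap ℓ ∘ v' →
        (∀ i, (v i).2 < ℓ) → (θ.Realize v ↔ θ.Realize v') := by
  obtain ⟨n, ⟨e⟩⟩ := Finite.exists_equiv_fin α
  obtain ⟨N, hN⟩ := hL n (θ.relabel e)
  refine ⟨N, fun ℓ hℓ v v' hv hv' hvv' hs => ?_⟩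
  have h := hN ℓ hℓ (v ∘ e.symm) (v' ∘ e.symm) (fun i j => hv _ _) (fun i j => hv' _ _)
    (by rw [← Function.comp_assoc, hvv', Function.comp_assoc]) (fun i => hs _)
  rw [Language.Formula.realize_relabel, Language.Formula.realize_relabel] at h
  simpa [Function.comp_assoc] using h

/-- Near a tuple, the truth of a formula depends only on the equality type. -/
theorem IsLevelDetermined.exists_level (hL : IsLevelDetermined L) {α : Type*} [Finite α]
    (θ : L.Formula α) (v : α → CantorOmega) : ∃ ℓ, LevelSplits ℓ v ∧
      ∀ v' : α → CantorOmega, levelMap ℓ ∘ v' = levelMap ℓ ∘ v →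
        (∀ i j, v i = v j → v' i = v' j) → (θ.Realize v ↔ θ.Realize v') := by
  obtain ⟨N, hN⟩ := hL.of_finite θ
  obtain ⟨K, hK⟩ := exists_levelSplits v
  obtain ⟨hsplit, hslice⟩ := hK (max N K) (le_max_right _ _)
  refine ⟨max N K, hsplit, fun v' hv' heq => ?_⟩
  -- The tuple `v'` splits as well: equal nodes force equal entries of `v`, hence equal entries of
  -- `v'`.
  refine hN _ (le_max_left _ _) v v' hsplit (fun i j hij => heq i j (hsplit i j ?_)) hv'.symm hslice
  have h := fun i => congrFun hv' i
  simp only [Function.comp_apply] at h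
  rw [← h i, ← h j, hij]

theorem IsLevelDetermined.asymptoticallySimilarTuples (hL : IsLevelDetermined L) {m : ℕ}
    (t : Fin m → ℕ) (ht : Function.Injective t) :
    AsymptoticallySimilarTuples L fun (η : Cantor) (j : Fin m) => ((η, t j) : CantorOmega) := by
  intro k θ
  obtain ⟨N, hN⟩ := hL.of_finite θ
  obtain ⟨K, hK⟩ := (Set.finite_range t).bddAbove
  -- The bound `K + 1` puts all slices `t j` below `ℓ`, where decisions have been made.
  refine ⟨max N (K + 1), fun ℓ hℓ η τ ⟨_, ⟨_, hη⟩, hητ⟩ => ?_⟩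
  refine hN ℓ ((le_max_left _ _).trans hℓ) _ _ ?_ ?_ ?_ ?_
  · rintro ⟨p, q⟩ ⟨p', q'⟩ hpq
    obtain ⟨h1, h2⟩ := Prod.mk.inj hpq
    obtain rfl := ht h2
    obtain rfl := hη h1
    rfl
  · rintro ⟨p, q⟩ ⟨p', q'⟩ hpq
    obtain ⟨h1, h2⟩ := Prod.mk.inj hpq
    obtain rfl := ht h2
    obtain rfl : p = p' := hη (((hητ p).trans h1).trans (hητ p').symm)
    rfl
  · ext1 ⟨p, q⟩
    exact Prod.ext (hητ p) rfl
  · rintro ⟨p, q⟩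
    exact (Nat.lt_succ_of_le (hK ⟨q, rfl⟩)).trans_le ((le_max_right _ _).trans hℓ)

theorem IsLevelDetermined.asymptoticallySimilar (hL : IsLevelDetermined L) (i : ℕ) :
    AsymptoticallySimilar L fun η : Cantor => ((η, i) : CantorOmega) := by
  intro k θ
  obtain ⟨N, hN⟩ := hL.asymptoticallySimilarTuples (fun _ : Fin 1 => i)
    (Function.injective_of_subsingleton _) k (θ.relabel fun j => (j, 0))
  refine ⟨N, fun ℓ hℓ η τ h => ?_⟩
  have := hN ℓ hℓ η τ h
  rwa [Language.Formula.realize_relabel, Language.Formula.realize_relabel] at this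

end LevelDetermined

/-! ### Boolean combinations of open sets. -/

section Topology

theorem isOpen_levelMap_preimage (ℓ : ℕ) (y : Level ℓ) : IsOpen {x | levelMap ℓ x = y} := by
  have : Continuous (levelMap ℓ) := by
    unfold levelMap restr
    fun_prop
  exact (isOpen_discrete {y}).preimage this

theorem IsBooleanCombinationOfOpens.iUnion {X ι : Type*} [TopologicalSpace X] [Finite ι]
    {D : ι → Set X} (hD : ∀ i, IsBooleanCombinationOfOpens (D i)) :
    IsBooleanCombinationOfOpens (⋃ i, D i) := by
  have h : ∀ S : Set ι, IsBooleanCombinationOfOpens (⋃ i ∈ S, D i) := by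
    intro S
    induction S, S.toFinite using Set.Finite.induction_on with
    | empty => simpa using! (BooleanSubalgebra.bot_mem (L := BooleanSubalgebra.closure {U : Set X | IsOpen U}))
    | insert _ _ ih =>
      rw [Set.biUnion_insert]
      exact BooleanSubalgebra.sup_mem (hD _) ih
  simpa using h Set.univ

theorem IsBooleanCombinationOfOpens.iInter {X ι : Type*} [TopologicalSpace X] [Finite ι]
    {D : ι → Set X} (hD : ∀ i, IsBooleanCombinationOfOpens (D i)) :
    IsBooleanCombinationOfOpens (⋂ i, D i) := by
  have := IsBooleanCombinationOfOpens.iUnion fun i => BooleanSubalgebra.compl_mem (hD i)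
  simpa [Set.compl_iUnion] using! BooleanSubalgebra.compl_mem this

theorem IsBooleanCombinationOfOpens.measurableSet {X : Type*} [TopologicalSpace X]
    [MeasurableSpace X] [BorelSpace X] {D : Set X} (hD : IsBooleanCombinationOfOpens D) :
    MeasurableSet D := by
  let B : BooleanSubalgebra (Set X) :=
    { carrier := {S | MeasurableSet S}
      supClosed' := fun _ hs _ ht => MeasurableSet.union hs ht
      infClosed' := fun _ hs _ ht => MeasurableSet.inter hs ht
      compl_mem' := fun hs => MeasurableSet.compl hs
      bot_mem' := MeasurableSet.empty }
  exact BooleanSubalgebra.closure_le (L := B) |>.2 (fun U hU => IsOpen.measurableSet hU) hD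

/-- A set which is relatively open in each piece of a finite partition given by closed conditions
is a Boolean combination of open sets. -/
theorem isBooleanCombinationOfOpens_of_locally {X ι : Type*} [TopologicalSpace X] [Finite ι]
    {C : ι → Set X} (hC : ∀ i, IsClosed (C i)) {D : Set X}
    (hD : ∀ x ∈ D, ∃ V, IsOpen V ∧ x ∈ V ∧ ∀ y ∈ V, (∀ i, x ∈ C i ↔ y ∈ C i) → y ∈ D) :
    IsBooleanCombinationOfOpens D := by
  choose! V hV hxV hVD using hD
  let P : Set ι → Set X := fun r => {x | ∀ i, x ∈ C i ↔ i ∈ r}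
  have hP : ∀ r, IsBooleanCombinationOfOpens (P r) := by
    intro r
    have : P r = ⋂ i, {x | x ∈ C i ↔ i ∈ r} := by
      ext x
      simp [P]
    rw [this]
    refine IsBooleanCombinationOfOpens.iInter fun i => ?_
    by_cases hi : i ∈ r
    · simp only [hi, iff_true]
      have := BooleanSubalgebra.subset_closure (s := {U : Set X | IsOpen U}) (hC i).isOpen_compl
      exact BooleanSubalgebra.compl_mem_iff.1 this
    · simp only [hi, iff_false]
      exact BooleanSubalgebra.subset_closure (hC i).isOpen_compl
  -- On the piece with pattern `r`, the set `D` is the trace of one open set, the union of the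
  -- neighbourhoods of its points of that pattern.
  have hDeq : D = ⋃ r : Set ι, (⋃ x ∈ D ∩ P r, V x) ∩ P r := by
    ext y
    simp only [Set.mem_iUnion, Set.mem_inter_iff, exists_prop]
    constructor
    · intro hy
      have hyP : y ∈ P {i | y ∈ C i} := fun i => Iff.rfl
      exact ⟨_, ⟨y, ⟨hy, hyP⟩, hxV y hy⟩, hyP⟩
    · rintro ⟨r, ⟨x, ⟨hx, hxP⟩, hyV⟩, hyP⟩
      exact hVD x hx y hyV fun i => (hxP i).trans (hyP i).symm
  rw [hDeq]
  refine IsBooleanCombinationOfOpens.iUnion fun r => BooleanSubalgebra.inf_mem ?_ (hP r)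
  exact BooleanSubalgebra.subset_closure (isOpen_biUnion fun x hx => hV x hx.1)

end Topology

/-! ### Positivity of the measure on cylinders. -/

section Measure

instance : IsFiniteMeasure
    (Measure.sum fun i : ℕ => (2⁻¹ : ℝ≥0∞) ^ (i + 1) • Measure.dirac i) where
  measure_univ_lt_top := by
    rw [Measure.sum_apply _ MeasurableSet.univ]
    simp [ENNReal.tsum_geometric_add_one, ENNReal.mul_lt_top]

instance : IsFiniteMeasure cantorOmegaMeasure := by
  unfold cantorOmegaMeasure
  infer_instance

theorem cantorOmegaMeasure_levelMap_pos (ℓ : ℕ) (y : Level ℓ) :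
    0 < cantorOmegaMeasure {x | levelMap ℓ x = y} := by
  classical
  have hset : {x : CantorOmega | levelMap ℓ x = y} =
      (Set.pi (Finset.range ℓ) fun j => {(levelLift ℓ y).1 j}) ×ˢ {y.2} := by
    ext x
    simp only [levelMap, Set.mem_ofPred_eq, Prod.ext_iff, funext_iff, restr, Set.mem_prod,
      Set.mem_pi, Finset.coe_range, Set.mem_Iio, Set.mem_singleton_iff, levelLift]
    refine and_congr_left fun _ => ⟨fun h j hj => ?_, fun h j => ?_⟩
    · simpa [hj] using h ⟨j, hj⟩
    · simpa using h j j.2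
  rw [hset, cantorOmegaMeasure, Measure.prod_prod, Measure.infinitePi_pi _ (by simp)]
  refine ENNReal.mul_pos ?_ ?_
  · refine Finset.prod_ne_zero_iff.2 fun j _ => ?_
    rw [PMF.toMeasure_apply_singleton _ _ (measurableSet_singleton _)]
    simp
  · rw [Measure.sum_apply _ (measurableSet_singleton _)]
    intro h
    have h' := ENNReal.tsum_eq_zero.1 h y.2
    simp at h'

end Measure

/-! ### Definable sets in a level-determined structure. -/

section LevelDetermined

variable {L : FirstOrder.Language.{u, v}} [L.Structure CantorOmega]

theorem IsLevelDetermined.isBooleanCombinationOfOpens_of_finite (hL : IsLevelDetermined L)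
    {α β : Type*} [Finite α] (θ : L.Formula α) (val : (β → CantorOmega) → α → CantorOmega)
    (hval : Continuous val) :
    IsBooleanCombinationOfOpens {x | θ.Realize (val x)} := by
  -- The closed conditions are the equalities between entries: with the equality pattern fixed,
  -- truth is locally constant.
  refine isBooleanCombinationOfOpens_of_locally
    (C := fun p : α × α => {x | val x p.1 = val x p.2}) (fun p => ?_) fun x hx => ?_
  · exact isClosed_eq (by fun_prop) (by fun_prop)
  · obtain ⟨ℓ, _, hℓ⟩ := hL.exists_level θ (val x)
    refine ⟨⋂ i, {y | levelMap ℓ (val y i) = levelMap ℓ (val x i)}, ?_, by simp, ?_⟩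
    · refine isOpen_iInter_of_finite fun i => ?_
      exact (isOpen_levelMap_preimage ℓ _).preimage (f := fun y => val y i) (by fun_prop)
    · intro y hy heq
      refine (hℓ (val y) ?_ fun i j => (heq (i, j)).1).1 hx
      ext1 i
      exact Set.mem_iInter.1 hy i

theorem IsLevelDetermined.isBooleanCombinationOfOpens_of_definable (hL : IsLevelDetermined L)
    {β : Type} {D : Set (β → CantorOmega)} (hD : (Set.univ : Set CantorOmega).Definable L D) :
    IsBooleanCombinationOfOpens D := by
  classical
  obtain ⟨φ, rfl⟩ := Set.definable_iff_exists_formula_sum.1 hD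
  -- Restricting to the free variables of `φ` leaves finitely many variables and parameters.
  have h := hL.isBooleanCombinationOfOpens_of_finite (β := β)
    (α := Language.BoundedFormula.freeVarFinset φ)
    (Language.BoundedFormula.restrictFreeVar φ id)
    (fun x i => Sum.elim (fun a : (Set.univ : Set CantorOmega) => (a : CantorOmega)) x i.1) (by
      refine continuous_pi fun ⟨i, _⟩ => ?_
      cases i <;> simp only [Sum.elim_inl, Sum.elim_inr] <;> fun_prop)
  refine (congrArg _ ?_).mp h
  ext x
  exact Language.BoundedFormula.realize_restrictFreeVar (φ := φ) (f := id) _ fun _ => rfl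

theorem IsLevelDetermined.solutionSet_pos (hL : IsLevelDetermined L) {k m : ℕ}
    (ψ : L.Formula (Fin k ⊕ Fin m)) (b : Fin m → CantorOmega) (hψ : IsNondegenerate ψ b) :
    MeasurableSet (solutionSet ψ b) ∧
      0 < Measure.pi (fun _ : Fin k => cantorOmegaMeasure) (solutionSet ψ b) := by
  constructor
  · refine IsBooleanCombinationOfOpens.measurableSet ?_
    refine hL.isBooleanCombinationOfOpens_of_finite ψ (fun x => Sum.elim x b) ?_
    refine continuous_pi fun i => ?_
    cases i <;> simp only [Sum.elim_inl, Sum.elim_inr] <;> fun_prop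
  · obtain ⟨a, ha, hinj, hab⟩ := hψ
    obtain ⟨ℓ, _, hℓ⟩ := hL.exists_level ψ (Sum.elim a b)
    -- Nondegeneracy leaves no equalities involving entries of `a` to preserve, so a full box of
    -- cylinders around `a` lies in the solution set.
    have hsub : (Set.pi Set.univ fun i => {x | levelMap ℓ x = levelMap ℓ (a i)}) ⊆
        solutionSet ψ b := by
      intro y hy
      refine (hℓ (Sum.elim y b) ?_ ?_).1 ha
      · ext1 i
        rcases i with i | i
        · exact hy i trivial
        · rfl
      · rintro (i | i) (j | j) hij
        · rw [hinj hij]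
        · exact absurd hij (hab i j)
        · exact absurd hij.symm (hab j i)
        · exact hij
    refine lt_of_lt_of_le ?_ (measure_mono hsub)
    rw [Measure.pi_pi, pos_iff_ne_zero]
    exact Finset.prod_ne_zero_iff.2 fun i _ => (cantorOmegaMeasure_levelMap_pos ℓ _).ne'

end LevelDetermined

theorem theorem6p1p4 (L : FirstOrder.Language.{u, v}) [Countable L.Symbols]
    (M : Type w) [L.Structure M] [Nonempty M] (hM : DclTrivial L M)
    (n : ℕ → ℕ) (Δ : ∀ m : ℕ, Set (L.Formula (Fin (n m)))) (hΔ : ∀ m, OmitsType M (Δ m)) :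
    ∃ _ : L.Structure CantorOmega, (
      -- elementary equivalence and size
      (M ≅[L] CantorOmega) ∧
      Cardinal.mk CantorOmega = Cardinal.continuum ∧
      -- each slice is asymptotically similar, and so are the tuples from finitely many slices
      (∀ i : ℕ, AsymptoticallySimilar L fun η : Cantor => ((η, i) : CantorOmega)) ∧
      (∀ (m : ℕ) (t : Fin m → ℕ), StrictMono t →
        AsymptoticallySimilarTuples L fun (η : Cantor) (j : Fin m) => ((η, t j) : CantorOmega)) ∧
      -- definable sets (with parameters) are finite Boolean combinations of open sets
      (∀ (k : ℕ) (D : Set (Fin k → CantorOmega)),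
        (univ : Set CantorOmega).Definable L D → IsBooleanCombinationOfOpens D) ∧
      -- non-degenerate definable sets are measurable of positive measure
      (∀ (k m : ℕ) (ψ : L.Formula (Fin k ⊕ Fin m)) (b : Fin m → CantorOmega),
        IsNondegenerate ψ b → MeasurableSet (solutionSet ψ b) ∧
          0 < Measure.pi (fun _ : Fin k => cantorOmegaMeasure) (solutionSet ψ b)) ∧
      -- atomicity and omission of types
      (IsAtomicModel L M → IsAtomicModel L CantorOmega) ∧
      (∀ m, OmitsType CantorOmega (Δ m))) := by
  -- The implication turns the first family into covers in either case: if `M` is not atomic, all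
  -- formulas are admitted.
  let 𝒟 : ∀ i : ℕ ⊕ ℕ, Set (L.Formula (Fin (Sum.elim id n i))) := fun i => match i with
    | Sum.inl _ => {φ | IsAtomicModel L M → IsCompleteFormula (L.completeTheory M) φ}
    | Sum.inr m => Language.Formula.not '' Δ m
  have h𝒟 : ∀ i (a : Fin (Sum.elim id n i) → M), ∃ D ∈ 𝒟 i, D.Realize a := by
    rintro (k | m) a
    · by_cases h : IsAtomicModel L M
      · obtain ⟨φ, hφ, hφa⟩ := h k a
        exact ⟨φ, fun _ => hφ, hφa⟩
      · exact ⟨⊤, fun h' => absurd h' h, Language.Formula.realize_top.2 trivial⟩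
    · obtain ⟨δ, hδ, hδa⟩ := hΔ m a
      exact ⟨δ.not, ⟨δ, hδ, rfl⟩, Language.Formula.realize_not.2 hδa⟩
  obtain ⟨str, hequiv, hL, hcover⟩ := exists_levelDetermined_structure hM _ 𝒟 h𝒟
  refine ⟨str, hequiv, by simp, hL.asymptoticallySimilar,
    fun m t ht => hL.asymptoticallySimilarTuples t ht.injective,
    fun k D hD => hL.isBooleanCombinationOfOpens_of_definable hD,
    fun k m ψ b hψ => hL.solutionSet_pos ψ b hψ, fun hat k a => ?_, fun m a => ?_⟩
  · obtain ⟨φ, hφ, hφa⟩ := hcover (Sum.inl k) a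
    refine ⟨φ, ?_, hφa⟩
    have hT : L.completeTheory M = L.completeTheory CantorOmega := hequiv
    rw [← hT]
    exact hφ hat
  · obtain ⟨_, ⟨δ, hδ, rfl⟩, hδa⟩ := hcover (Sum.inr m) a
    exact ⟨δ, hδ, Language.Formula.realize_not.1 hδa⟩
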